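/- Let $d\in\mathbb N$. Let $\mathbb W_0$ be the Weyl $*$-algebra, i.e. the complex vector space with basis the monomials $u_\alpha v_\beta$ ($\alpha,\beta\in\mathbb R^d$), with the product and involution determined by $$u_\alpha v_\beta=e^{i\alpha\cdot\beta}v_\beta u_\alpha,\quad u_\alpha u_{\alpha'}=u_{\alpha+\alpha'},\quad v_\beta v_{\beta'}=v_{\beta+\beta'},\quad u_\alpha^*=u_{-\alpha},\quad v_\beta^*=v_{-\beta}.$$ Let $\mathbb W$ be the Weyl $C^*$-algebra, i.e. the completion of $\mathbb W_0$ in the norm $\|a\|=\sup_\rho\|\rho(a)\|$, where $\rho$ runs over all $*$-representations of $\mathbb W_0$ by bounded operators on Hilbert spaces. Let $\mathbb V=C^*(\{v_\beta : \beta\in\mathbb R^d\})\subset\mathbb W$, and let $\tau_\lambda(a)=v_\lambda a v_\lambda^*$ for $a\in\mathbb W$, $\lambda\in\mathbb R^d$. For a unital $C^*$-algebra $A$ let $\mathcal S_A$ be the set of states (normalized positive linear functionals) of $A$ with the weak-$*$ topology, and let $\mathcal P_A$ be the set of pure states, i.e. the extreme points of $\mathcal S_A$. Put $$\mathcal S_{\mathbb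 W}^\tau=\{\omega\in\mathcal S_{\mathbb W} : \omega\circ\tau_\lambda=\omega\ \text{for all}\ \lambda\in\mathbb R^d\},\qquad \mathcal P_{\mathbb W}^\tau=\mathcal S_{\mathbb W}^\tau\cap\mathcal P_{\mathbb W}.$$ Then for every $a\in\mathbb W$ the ergodic mean $$\langle a\rangle=\lim_{L\to+\infty}\frac1{(2L)^d}\int_{[-L,L]^d}\tau_\lambda(a)\,d\lambda$$ (Bochner integrals, limit in norm) exists and belongs to $\mathbb V$. The prescription $$\omega(a)=\widetilde\omega(\langle a\rangle),\qquad a\in\mathbb W,$$ defines a homeomorphism $\widetilde\omega\mapsto\omega$ from $\mathcal S_{\mathbb V}$ onto $\mathcal S_{\mathbb W}^\tau$. Moreover, this homeomorphism restricts to a homeomorphism from $\mathcal P_{\mathbb V}$ onto $\mathcal P_{\mathbb W}^\tau$. -/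

import Mathlib

open Filter Topology MeasureTheory
open scoped ComplexOrder

/-! ### The Weyl star-algebra -/

/-- The Weyl `*`-algebra with `d` degrees of freedom: formal complex linear combinations of the
monomials `u_α v_β`, the monomial `u_α v_β` being indexed by the pair `(α, β)`. -/
def WeylStarAlgebra (d : ℕ) : Type :=
  (EuclideanSpace ℝ (Fin d) × EuclideanSpace ℝ (Fin d)) →₀ ℂ

namespace WeylStarAlgebra

variable {d : ℕ}

noncomputable instance : AddCommGroup (WeylStarAlgebra d) :=
  inferInstanceAs
    (AddCommGroup ((EuclideanSpace ℝ (Fin d) × EuclideanSpace ℝ (Fin d)) →₀ ℂ))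

noncomputable instance : Module ℂ (WeylStarAlgebra d) :=
  inferInstanceAs
    (Module ℂ ((EuclideanSpace ℝ (Fin d) × EuclideanSpace ℝ (Fin d)) →₀ ℂ))

/-- The phase `exp (-i α'·β)`, which appears in
`(u_α v_β) (u_α' v_β') = exp (-i α'·β) u_(α+α') v_(β+β')`. -/
noncomputable def phase (z w : EuclideanSpace ℝ (Fin d) × EuclideanSpace ℝ (Fin d)) : ℂ :=
  Complex.exp (-(Complex.I * ((inner ℝ w.1 z.2 : ℝ) : ℂ)))

/-- The element `c u_α v_β`, where `z = (α, β)`. -/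
noncomputable def mono (z : EuclideanSpace ℝ (Fin d) × EuclideanSpace ℝ (Fin d)) (c : ℂ) :
    WeylStarAlgebra d :=
  Finsupp.single z c

theorem mono_zero (z : EuclideanSpace ℝ (Fin d) × EuclideanSpace ℝ (Fin d)) :
    mono z 0 = 0 :=
  Finsupp.single_zero z

theorem mono_add (z : EuclideanSpace ℝ (Fin d) × EuclideanSpace ℝ (Fin d)) (a b : ℂ) :
    mono z (a + b) = mono z a + mono z b :=
  Finsupp.single_add z a b

/-- The linear extension of a map given on the monomials. -/
noncomputable def extend {M : Type} [AddCommGroup M] [Module ℂ M]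
    (f : EuclideanSpace ℝ (Fin d) × EuclideanSpace ℝ (Fin d) → M) : WeylStarAlgebra d →ₗ[ℂ] M :=
  Finsupp.linearCombination ℂ f

theorem extend_mono {M : Type} [AddCommGroup M] [Module ℂ M]
    (f : EuclideanSpace ℝ (Fin d) × EuclideanSpace ℝ (Fin d) → M)
    (z : EuclideanSpace ℝ (Fin d) × EuclideanSpace ℝ (Fin d)) (c : ℂ) :
    extend f (mono z c) = c • f z :=
  Finsupp.linearCombination_single ℂ c z

/-- Multiplication, as the bilinear extension of the product of monomials. -/
noncomputable def mulMap :
    WeylStarAlgebra d →ₗ[ℂ] WeylStarAlgebra d →ₗ[ℂ] WeylStarAlgebra d :=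
  extend (fun z => extend (fun w => mono (z + w) (phase z w)))

/-- The involution, as the conjugate-linear extension of
`(u_α v_β)^* = v_(-β) u_(-α) = exp (-i α·β) u_(-α) v_(-β)`. -/
noncomputable def starMap : WeylStarAlgebra d →+ WeylStarAlgebra d :=
  Finsupp.liftAddHom (fun z =>
    { toFun := fun c : ℂ => mono (-z) (starRingEnd ℂ c * phase z z)
      map_zero' := by rw [map_zero, zero_mul, mono_zero]
      map_add' := fun a b => by rw [map_add, add_mul, mono_add] })

theorem starMap_mono (z : EuclideanSpace ℝ (Fin d) × EuclideanSpace ℝ (Fin d)) (c : ℂ) :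
    starMap (mono z c) = mono (-z) (starRingEnd ℂ c * phase z z) :=
  Finsupp.liftAddHom_apply_single _ z c

noncomputable instance : Mul (WeylStarAlgebra d) := ⟨fun a b => mulMap a b⟩

noncomputable instance : One (WeylStarAlgebra d) := ⟨mono 0 1⟩

noncomputable instance : Star (WeylStarAlgebra d) := ⟨fun a => starMap a⟩

theorem mul_def (a b : WeylStarAlgebra d) : a * b = mulMap a b := rfl

theorem one_def : (1 : WeylStarAlgebra d) = mono 0 1 := rfl

theorem star_def (a : WeylStarAlgebra d) : star a = starMap a := rfl

theorem smul_mono (c e : ℂ) (z : EuclideanSpace ℝ (Fin d) × EuclideanSpace ℝ (Fin d)) :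
    c • mono z e = mono z (c * e) :=
  Finsupp.smul_single' c z e

theorem mono_mul_mono (z w : EuclideanSpace ℝ (Fin d) × EuclideanSpace ℝ (Fin d)) (a b : ℂ) :
    mono z a * mono w b = mono (z + w) (a * b * phase z w) := by
  rw [mul_def, mulMap, extend_mono, LinearMap.smul_apply, extend_mono, smul_mono, smul_mono,
    mul_assoc]

theorem star_mono (z : EuclideanSpace ℝ (Fin d) × EuclideanSpace ℝ (Fin d)) (a : ℂ) :
    star (mono z a) = mono (-z) (starRingEnd ℂ a * phase z z) :=
  starMap_mono z a

theorem induction_mono {p : WeylStarAlgebra d → Prop} (a : WeylStarAlgebra d) (h0 : p 0)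
    (hadd : ∀ a b, p a → p b → p (a + b)) (hm : ∀ z c, p (mono z c)) : p a :=
  Finsupp.induction_linear a h0 hadd hm

theorem add_mul_aux (a b c : WeylStarAlgebra d) : (a + b) * c = a * c + b * c := by
  simp [mul_def]

theorem mul_add_aux (a b c : WeylStarAlgebra d) : a * (b + c) = a * b + a * c := by
  simp [mul_def]

theorem zero_mul_aux (a : WeylStarAlgebra d) : 0 * a = 0 := by simp [mul_def]

theorem mul_zero_aux (a : WeylStarAlgebra d) : a * 0 = 0 := by simp [mul_def]

theorem phase_cocycle (x y z : EuclideanSpace ℝ (Fin d) × EuclideanSpace ℝ (Fin d)) :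
    phase x y * phase (x + y) z = phase y z * phase x (y + z) := by
  simp only [phase, ← Complex.exp_add, Prod.fst_add, Prod.snd_add, inner_add_left,
    inner_add_right]
  congr 1
  push_cast
  ring

theorem phase_star (x y : EuclideanSpace ℝ (Fin d) × EuclideanSpace ℝ (Fin d)) :
    starRingEnd ℂ (phase x y) * phase (x + y) (x + y)
      = phase x x * phase y y * phase (-y) (-x) := by
  simp only [phase, ← Complex.exp_conj, ← Complex.exp_add, Prod.fst_add, Prod.snd_add,
    inner_add_left, inner_add_right, Prod.fst_neg, Prod.snd_neg, inner_neg_left, inner_neg_right,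
    map_neg, map_mul, Complex.conj_I, Complex.conj_ofReal]
  congr 1
  push_cast
  ring

theorem phase_star_star (x : EuclideanSpace ℝ (Fin d) × EuclideanSpace ℝ (Fin d)) :
    starRingEnd ℂ (phase x x) * phase (-x) (-x) = 1 := by
  simp only [phase, ← Complex.exp_conj, ← Complex.exp_add, Prod.fst_neg, Prod.snd_neg,
    inner_neg_left, inner_neg_right, map_neg, map_mul, Complex.conj_I, Complex.conj_ofReal]
  rw [← Complex.exp_zero]
  congr 1
  push_cast
  ring

noncomputable instance : Ring (WeylStarAlgebra d) where
  __ := (inferInstance : AddCommGroup (WeylStarAlgebra d))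
  left_distrib := mul_add_aux
  right_distrib := add_mul_aux
  zero_mul := zero_mul_aux
  mul_zero := mul_zero_aux
  mul_assoc a b c := by
    induction a using induction_mono with
    | h0 => simp only [zero_mul_aux]
    | hadd a a' h h' => simp only [add_mul_aux, h, h']
    | hm x r =>
      induction b using induction_mono with
      | h0 => simp only [zero_mul_aux, mul_zero_aux]
      | hadd b b' h h' => simp only [add_mul_aux, mul_add_aux, h, h']
      | hm y s =>
        induction c using induction_mono with
        | h0 => simp only [mul_zero_aux]
        | hadd c c' h h' => simp only [mul_add_aux, h, h']
        | hm z t =>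
          simp only [mono_mul_mono, add_assoc]
          congr 1
          linear_combination r * s * t * phase_cocycle x y z
  one_mul a := by
    induction a using induction_mono with
    | h0 => simp only [mul_zero_aux]
    | hadd a a' h h' => simp only [mul_add_aux, h, h']
    | hm x r => simp [one_def, mono_mul_mono, phase]
  mul_one a := by
    induction a using induction_mono with
    | h0 => simp only [zero_mul_aux]
    | hadd a a' h h' => simp only [add_mul_aux, h, h']
    | hm x r => simp [one_def, mono_mul_mono, phase]

noncomputable instance : Algebra ℂ (WeylStarAlgebra d) :=
  Algebra.ofModule (fun c a b => by simp [mul_def]) (fun c a b => by simp [mul_def])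

noncomputable instance : StarRing (WeylStarAlgebra d) where
  star_add a b := by simp [star_def]
  star_involutive a := by
    induction a using induction_mono with
    | h0 => simp [star_def]
    | hadd a a' h h' => simpa [star_def] using congrArg₂ (· + ·) h h'
    | hm x r =>
      rw [star_mono, star_mono, neg_neg, map_mul, Complex.conj_conj, mul_assoc, phase_star_star,
        mul_one]
  star_mul a b := by
    induction a using induction_mono with
    | h0 => simp [star_def]
    | hadd a a' h h' =>
      rw [add_mul, star_def, map_add, ← star_def, ← star_def, h, h', star_def (a + a'), map_add,
        mul_add]
      rfl
    | hm x r =>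
      induction b using induction_mono with
      | h0 => simp [star_def]
      | hadd b b' h h' =>
        rw [mul_add, star_def, map_add, ← star_def, ← star_def, h, h', star_def (b + b'), map_add,
          add_mul]
        rfl
      | hm y s =>
        simp only [mono_mul_mono, star_mono, map_mul, neg_add_rev]
        congr 1
        linear_combination starRingEnd ℂ r * starRingEnd ℂ s * phase_star x y

instance : StarModule ℂ (WeylStarAlgebra d) where
  star_smul c a := by
    induction a using induction_mono with
    | h0 => simp
    | hadd a a' h h' => simp only [smul_add, star_add, h, h']
    | hm x r => simp only [smul_mono, star_mono, map_mul, mul_assoc]; rfl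

/-! ### The minimal regular norm -/

/-- The values `‖ρ(a)‖`, where `ρ` runs through the `*`-representations of the Weyl `*`-algebra
by bounded operators on Hilbert spaces. -/
def repNorms (a : WeylStarAlgebra d) : Set ℝ :=
  {r | ∃ (H : Type) (_ : NormedAddCommGroup H) (_ : InnerProductSpace ℂ H) (_ : CompleteSpace H)
    (ρ : WeylStarAlgebra d →⋆ₐ[ℂ] (H →L[ℂ] H)), r = ‖ρ a‖}

theorem repNorms_nonempty (a : WeylStarAlgebra d) : (repNorms a).Nonempty := by
  have hs : Subsingleton (EuclideanSpace ℂ (Fin 0)) := inferInstance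
  have hs' : Subsingleton (EuclideanSpace ℂ (Fin 0) →L[ℂ] EuclideanSpace ℂ (Fin 0)) :=
    ⟨fun f g => ContinuousLinearMap.ext fun x => Subsingleton.elim _ _⟩
  exact ⟨_, EuclideanSpace ℂ (Fin 0), inferInstance, inferInstance, inferInstance,
    { toFun := fun _ => 0
      map_one' := Subsingleton.elim _ _
      map_mul' := fun _ _ => Subsingleton.elim _ _
      map_zero' := Subsingleton.elim _ _
      map_add' := fun _ _ => Subsingleton.elim _ _
      commutes' := fun _ => Subsingleton.elim _ _
      map_star' := fun _ => Subsingleton.elim _ _ }, rfl⟩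

theorem mono_star_mul (z : EuclideanSpace ℝ (Fin d) × EuclideanSpace ℝ (Fin d)) :
    star (mono z 1) * mono z 1 = (1 : WeylStarAlgebra d) := by
  rw [star_mono, mono_mul_mono, one_def, neg_add_cancel]
  congr 1
  simp only [phase, map_one, one_mul, mul_one, ← Complex.exp_add, Prod.snd_neg, inner_neg_right]
  rw [← Complex.exp_zero]
  congr 1
  push_cast
  ring

theorem bddAbove_repNorms (a : WeylStarAlgebra d) : BddAbove (repNorms a) := by
  induction a using induction_mono with
  | h0 =>
    refine ⟨0, ?_⟩
    rintro r ⟨H, _, _, _, ρ, rfl⟩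
    simp
  | hadd a b ha hb =>
    obtain ⟨A, hA⟩ := ha
    obtain ⟨B, hB⟩ := hb
    refine ⟨A + B, ?_⟩
    rintro r ⟨H, i1, i2, i3, ρ, rfl⟩
    rw [map_add]
    exact (norm_add_le _ _).trans
      (add_le_add (hA ⟨H, i1, i2, i3, ρ, rfl⟩) (hB ⟨H, i1, i2, i3, ρ, rfl⟩))
  | hm z c =>
    refine ⟨‖c‖, ?_⟩
    rintro r ⟨H, i1, i2, i3, ρ, rfl⟩
    have h1 : ‖ρ (mono z 1)‖ * ‖ρ (mono z 1)‖ ≤ 1 := by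
      rw [← CStarRing.norm_star_mul_self, ← map_star, ← map_mul, mono_star_mul, map_one]
      exact ContinuousLinearMap.norm_id_le
    have h2 : ‖ρ (mono z 1)‖ ≤ 1 := by nlinarith [norm_nonneg (ρ (mono z 1))]
    have h3 : mono z c = c • (mono z 1 : WeylStarAlgebra d) := by rw [smul_mono, mul_one]
    rw [h3, map_smul, norm_smul]
    exact mul_le_of_le_one_right (norm_nonneg c) h2

/-- The minimal regular norm `‖a‖ = sup_ρ ‖ρ(a)‖`. -/
noncomputable def regNorm (a : WeylStarAlgebra d) : ℝ := sSup (repNorms a)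

theorem le_regNorm {H : Type} [NormedAddCommGroup H] [InnerProductSpace ℂ H] [CompleteSpace H]
    (ρ : WeylStarAlgebra d →⋆ₐ[ℂ] (H →L[ℂ] H)) (a : WeylStarAlgebra d) : ‖ρ a‖ ≤ regNorm a :=
  le_csSup (bddAbove_repNorms a) ⟨H, _, _, _, ρ, rfl⟩

theorem regNorm_le {a : WeylStarAlgebra d} {C : ℝ}
    (h : ∀ (H : Type) [NormedAddCommGroup H] [InnerProductSpace ℂ H] [CompleteSpace H]
      (ρ : WeylStarAlgebra d →⋆ₐ[ℂ] (H →L[ℂ] H)), ‖ρ a‖ ≤ C) : regNorm a ≤ C := by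
  refine csSup_le (repNorms_nonempty a) ?_
  rintro r ⟨H, i1, i2, i3, ρ, rfl⟩
  exact h H ρ

theorem regNorm_nonneg (a : WeylStarAlgebra d) : 0 ≤ regNorm a := by
  refine Real.sSup_nonneg ?_
  rintro r ⟨H, i1, i2, i3, ρ, rfl⟩
  exact norm_nonneg _

/-- The minimal regular norm makes the Weyl `*`-algebra a seminormed ring. -/
noncomputable def regSeminorm (d : ℕ) : RingSeminorm (WeylStarAlgebra d) where
  toFun := regNorm
  map_zero' := le_antisymm (regNorm_le fun H _ _ _ ρ => by simp) (regNorm_nonneg 0)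
  add_le' a b := regNorm_le fun H _ _ _ ρ => by
    rw [map_add]
    exact (norm_add_le _ _).trans (add_le_add (le_regNorm ρ a) (le_regNorm ρ b))
  neg' a := by
    have h : ∀ b : WeylStarAlgebra d, regNorm (-b) ≤ regNorm b := fun b =>
      regNorm_le fun H _ _ _ ρ => by
        rw [map_neg, norm_neg]
        exact le_regNorm ρ b
    exact le_antisymm (h a) (by simpa using h (-a))
  mul_le' a b := regNorm_le fun H _ _ _ ρ => by
    rw [map_mul]
    exact (norm_mul_le _ _).trans
      (mul_le_mul (le_regNorm ρ a) (le_regNorm ρ b) (norm_nonneg _) (regNorm_nonneg a))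

noncomputable instance : SeminormedRing (WeylStarAlgebra d) := (regSeminorm d).toSeminormedRing

theorem norm_def (a : WeylStarAlgebra d) : ‖a‖ = regNorm a := rfl

noncomputable instance : NormedAlgebra ℂ (WeylStarAlgebra d) where
  norm_smul_le c a := regNorm_le fun H _ _ _ ρ => by
    rw [map_smul, norm_smul]
    exact mul_le_mul_of_nonneg_left (le_regNorm ρ a) (norm_nonneg c)

theorem norm_star_le (a : WeylStarAlgebra d) : ‖star a‖ ≤ ‖a‖ :=
  regNorm_le fun H _ _ _ ρ => by
    rw [map_star, norm_star]
    exact le_regNorm ρ a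

instance : NormedStarGroup (WeylStarAlgebra d) := ⟨norm_star_le⟩

theorem norm_mul_self_le_star (a : WeylStarAlgebra d) : ‖a‖ * ‖a‖ ≤ ‖star a * a‖ := by
  have h : ‖a‖ ≤ Real.sqrt ‖star a * a‖ := regNorm_le fun H _ _ _ ρ => by
    refine Real.le_sqrt_of_sq_le ?_
    rw [sq, ← CStarRing.norm_star_mul_self, ← map_star, ← map_mul]
    exact le_regNorm ρ _
  calc ‖a‖ * ‖a‖ ≤ Real.sqrt ‖star a * a‖ * Real.sqrt ‖star a * a‖ :=
        mul_self_le_mul_self (norm_nonneg a) h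
    _ = ‖star a * a‖ := Real.mul_self_sqrt (norm_nonneg _)

end WeylStarAlgebra

/-! ### The Weyl `C^*`-algebra -/

/-- The Weyl `C^*`-algebra: the completion of the Weyl `*`-algebra in the minimal regular norm. -/
def WeylAlgebra (d : ℕ) : Type := UniformSpace.Completion (WeylStarAlgebra d)

namespace WeylAlgebra

variable {d : ℕ}

noncomputable instance : NormedRing (WeylAlgebra d) :=
  inferInstanceAs (NormedRing (UniformSpace.Completion (WeylStarAlgebra d)))

instance : CompleteSpace (WeylAlgebra d) :=
  inferInstanceAs (CompleteSpace (UniformSpace.Completion (WeylStarAlgebra d)))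

noncomputable instance : Algebra ℂ (WeylAlgebra d) :=
  inferInstanceAs (Algebra ℂ (UniformSpace.Completion (WeylStarAlgebra d)))

noncomputable instance : NormedAlgebra ℂ (WeylAlgebra d) where
  norm_smul_le := fun c a =>
    norm_smul_le (β := UniformSpace.Completion (WeylStarAlgebra d)) c a

/-- The canonical map of the Weyl `*`-algebra to its completion. -/
noncomputable def of (a : WeylStarAlgebra d) : WeylAlgebra d :=
  UniformSpace.Completion.coe' a

theorem of_add (a b : WeylStarAlgebra d) : of (a + b) = of a + of b :=
  UniformSpace.Completion.coe_add a b

theorem of_mul (a b : WeylStarAlgebra d) : of (a * b) = of a * of b :=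
  UniformSpace.Completion.coe_mul a b

theorem of_one : of (1 : WeylStarAlgebra d) = 1 := rfl

theorem of_smul (c : ℂ) (a : WeylStarAlgebra d) : of (c • a) = c • of a :=
  UniformSpace.Completion.coe_smul c a

theorem norm_of (a : WeylStarAlgebra d) : ‖of a‖ = ‖a‖ := UniformSpace.Completion.norm_coe a

theorem continuous_of : Continuous (of : WeylStarAlgebra d → WeylAlgebra d) :=
  UniformSpace.Completion.continuous_coe _

theorem denseRange_of : DenseRange (of : WeylStarAlgebra d → WeylAlgebra d) :=
  UniformSpace.Completion.denseRange_coe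

theorem uniformContinuous_star :
    UniformContinuous (star : WeylStarAlgebra d → WeylStarAlgebra d) :=
  (AddMonoidHomClass.isometry_of_norm (starAddEquiv : WeylStarAlgebra d ≃+ WeylStarAlgebra d)
    (fun a => norm_star a)).uniformContinuous

/-- The involution of the Weyl `C^*`-algebra extends that of the Weyl `*`-algebra by
continuity. -/
noncomputable instance : Star (WeylAlgebra d) :=
  ⟨UniformSpace.Completion.map (star : WeylStarAlgebra d → WeylStarAlgebra d)⟩

theorem star_of (a : WeylStarAlgebra d) : star (of a) = of (star a) :=
  UniformSpace.Completion.map_coe uniformContinuous_star a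

theorem continuous_star_aux : Continuous (star : WeylAlgebra d → WeylAlgebra d) :=
  UniformSpace.Completion.continuous_map

theorem induction_of {p : WeylAlgebra d → Prop} (a : WeylAlgebra d)
    (hc : IsClosed {a | p a}) (h : ∀ a, p (of a)) : p a :=
  denseRange_of.induction_on a hc h

noncomputable instance : StarRing (WeylAlgebra d) where
  star_involutive a := by
    induction a using induction_of with
    | hc => exact isClosed_eq (continuous_star_aux.comp continuous_star_aux) continuous_id
    | h a => rw [star_of, star_of, star_star]
  star_add a b := by
    induction a using induction_of with
    | hc =>
      exact isClosed_eq (continuous_star_aux.comp (continuous_id.add continuous_const))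
        (continuous_star_aux.add continuous_const)
    | h a =>
      induction b using induction_of with
      | hc =>
        exact isClosed_eq (continuous_star_aux.comp (continuous_const.add continuous_id))
          (continuous_const.add continuous_star_aux)
      | h b => rw [← of_add, star_of, star_of, star_of, star_add, of_add]
  star_mul a b := by
    induction a using induction_of with
    | hc =>
      exact isClosed_eq (continuous_star_aux.comp (continuous_id.mul continuous_const))
        (continuous_const.mul continuous_star_aux)
    | h a =>
      induction b using induction_of with
      | hc =>
        exact isClosed_eq (continuous_star_aux.comp (continuous_const.mul continuous_id))
          (continuous_star_aux.mul continuous_const)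
      | h b => rw [← of_mul, star_of, star_of, star_of, star_mul, of_mul]

instance : StarModule ℂ (WeylAlgebra d) where
  star_smul c a := by
    induction a using induction_of with
    | hc =>
      exact isClosed_eq (continuous_star_aux.comp (continuous_id.const_smul c))
        (continuous_star_aux.const_smul (star c))
    | h a => rw [← of_smul, star_of, star_of, star_smul, of_smul]

instance : CStarRing (WeylAlgebra d) where
  norm_mul_self_le a := by
    induction a using induction_of with
    | hc =>
      exact isClosed_le (continuous_norm.mul continuous_norm)
        (continuous_norm.comp (continuous_star_aux.mul continuous_id))
    | h a =>
      rw [star_of, ← of_mul, norm_of, norm_of]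
      exact WeylStarAlgebra.norm_mul_self_le_star a

noncomputable instance : CStarAlgebra (WeylAlgebra d) where

/-- The generators `u_α`. -/
noncomputable def u (α : EuclideanSpace ℝ (Fin d)) : WeylAlgebra d :=
  of (WeylStarAlgebra.mono (α, 0) 1)

/-- The generators `v_β`. -/
noncomputable def v (β : EuclideanSpace ℝ (Fin d)) : WeylAlgebra d :=
  of (WeylStarAlgebra.mono (0, β) 1)

/-- The `C^*`-subalgebra `𝕍 = C^*(v_β)` generated by the `v_β`. -/
noncomputable def subalgV (d : ℕ) : StarSubalgebra ℂ (WeylAlgebra d) :=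
  (StarAlgebra.adjoin ℂ (Set.range (v : EuclideanSpace ℝ (Fin d) → WeylAlgebra d))).topologicalClosure

noncomputable instance : CStarAlgebra (subalgV d) :=
  StarSubalgebra.cstarAlgebra (subalgV d)
    (h_closed := StarSubalgebra.isClosed_topologicalClosure _)

/-- The translations `τ_λ(a) = v_λ a v_λ^*`. -/
noncomputable def translation (l : EuclideanSpace ℝ (Fin d)) (a : WeylAlgebra d) : WeylAlgebra d :=
  v l * a * star (v l)

/-- The cube `Λ_L = [-L, L]^d`. -/
def cube (d : ℕ) (L : ℝ) : Set (EuclideanSpace ℝ (Fin d)) := {x | ∀ i, x i ∈ Set.Icc (-L) L}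

/-- The mean `|Λ_L|⁻¹ ∫_{Λ_L} τ_λ(a) dλ` over the cube of volume `|Λ_L| = (2L)^d`, as a Bochner
integral. -/
noncomputable def cubeMean (L : ℝ) (a : WeylAlgebra d) : WeylAlgebra d :=
  ((2 * L) ^ d)⁻¹ • ∫ l in cube d L, translation l a

/-- The ergodic mean `⟨a⟩ = lim_{L → ∞} |Λ_L|⁻¹ ∫_{Λ_L} τ_λ(a) dλ` (limit in norm). -/
noncomputable def ergodicMean (a : WeylAlgebra d) : WeylAlgebra d :=
  limUnder atTop (fun L : ℝ => cubeMean L a)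

end WeylAlgebra

/-! ### States -/

/-- The state space of a unital `C^*`-algebra, as a subset of the dual with the weak-`*`
topology: the normalized positive linear functionals. -/
def stateSpace (A : Type) [CStarAlgebra A] : Set (WeakDual ℂ A) :=
  {ω | ω 1 = 1 ∧ ∀ a : A, 0 ≤ ω (star a * a)}

/-- The pure states: the extremal points of the state space. -/
def pureStates (A : Type) [CStarAlgebra A] : Set (WeakDual ℂ A) :=
  Set.extremePoints ℝ (stateSpace A)

/-- The translationally invariant states of the Weyl `C^*`-algebra. -/
def invStates (d : ℕ) : Set (WeakDual ℂ (WeylAlgebra d)) :=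
  {ω | ω ∈ stateSpace (WeylAlgebra d) ∧
    ∀ (l : EuclideanSpace ℝ (Fin d)) (a : WeylAlgebra d), ω (WeylAlgebra.translation l a) = ω a}

/-- The translationally invariant pure states of the Weyl `C^*`-algebra. -/
def pureInvStates (d : ℕ) : Set (WeakDual ℂ (WeylAlgebra d)) :=
  invStates d ∩ pureStates (WeylAlgebra d)

/-! Conjugation by `v l` multiplies the monomial `u_α v_β` by the character `exp (-i α·l)`. The mean
of this character over growing cubes tends to 1 if `α = 0` and to 0 otherwise. Cube means are
contractions, so convergence passes from the dense Weyl `*`-algebra to all of `𝕎`; the mean keeps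
only the terms with `α = 0` and so lands in `𝕍`.

The mean is a conditional expectation onto `𝕍`: it fixes `𝕍`, commutes with multiplication by
elements of `𝕍`, and makes the `u_α` orthonormal. Hence `⟨a^* a⟩` is a sum of squares from `𝕍` when
`a` is a finite sum (`ergodicMean_star_mul_self`), so composing a state of `𝕍` with the mean gives
an invariant state. Conversely, an invariant state does not change under averaging, so it is
determined by its restriction to `𝕍`. Extension and restriction are thus inverse to each other,
affine and weak-`*` continuous.

For pure states, invariance comes for free: `𝕍` is commutative, so a pure state of `𝕍` has modulus
one on each `v l` (`conj_mul_self_of_mem_pureStates`), and any state of `𝕎` with that property is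
invariant under conjugation by `v l` (`map_conj_unitary`). Therefore every convex decomposition of
an extended pure state consists of invariant states and is governed by its restriction to `𝕍`. -/

namespace WeylAlgebra

variable {d : ℕ}

/-! ### Translations -/

theorem of_mono_mul_of_mono (z w : EuclideanSpace ℝ (Fin d) × EuclideanSpace ℝ (Fin d))
    (a b : ℂ) :
    of (WeylStarAlgebra.mono z a) * of (WeylStarAlgebra.mono w b)
      = of (WeylStarAlgebra.mono (z + w) (a * b * WeylStarAlgebra.phase z w)) := by
  rw [← of_mul, WeylStarAlgebra.mono_mul_mono]

theorem star_v (β : EuclideanSpace ℝ (Fin d)) : star (v β) = v (-β) := by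
  rw [v, star_of, WeylStarAlgebra.star_mono, v]
  simp [WeylStarAlgebra.phase]

theorem v_mul_v (β γ : EuclideanSpace ℝ (Fin d)) : v β * v γ = v (β + γ) := by
  rw [v, v, of_mono_mul_of_mono, v]
  simp [WeylStarAlgebra.phase]

theorem v_zero : v (0 : EuclideanSpace ℝ (Fin d)) = 1 := rfl

theorem star_v_mul_v (β : EuclideanSpace ℝ (Fin d)) : star (v β) * v β = 1 := by
  rw [star_v, v_mul_v, neg_add_cancel, v_zero]

theorem v_mul_star_v (β : EuclideanSpace ℝ (Fin d)) : v β * star (v β) = 1 := by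
  rw [star_v, v_mul_v, add_neg_cancel, v_zero]

theorem of_mono_mul_v (α β γ : EuclideanSpace ℝ (Fin d)) (c : ℂ) :
    of (WeylStarAlgebra.mono (α, β) c) * v γ = of (WeylStarAlgebra.mono (α, β + γ) c) := by
  rw [v, of_mono_mul_of_mono]
  simp [WeylStarAlgebra.phase]

/-- Monomials are joint eigenvectors of all translations. This reduces the ergodic theorem to means
of characters. -/
theorem translation_of_mono (l α β : EuclideanSpace ℝ (Fin d)) (c : ℂ) :
    translation l (of (WeylStarAlgebra.mono (α, β) c))
      = Complex.exp (-(Complex.I * ((inner ℝ α l : ℝ) : ℂ))) •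
        of (WeylStarAlgebra.mono (α, β) c) := by
  rw [translation, star_v, v, of_mono_mul_of_mono, Prod.mk_add_mk, of_mono_mul_v, ← of_smul,
    WeylStarAlgebra.smul_mono]
  simp [WeylStarAlgebra.phase, mul_comm]

theorem translation_add (l : EuclideanSpace ℝ (Fin d)) (a b : WeylAlgebra d) :
    translation l (a + b) = translation l a + translation l b := by
  simp [translation, mul_add, add_mul]

theorem translation_sub (l : EuclideanSpace ℝ (Fin d)) (a b : WeylAlgebra d) :
    translation l (a - b) = translation l a - translation l b := by
  simp [translation, mul_sub, sub_mul]

theorem translation_smul (l : EuclideanSpace ℝ (Fin d)) (c : ℂ) (a : WeylAlgebra d) :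
    translation l (c • a) = c • translation l a := by
  simp [translation]

theorem v_mem_unitary (l : EuclideanSpace ℝ (Fin d)) : v l ∈ unitary (WeylAlgebra d) :=
  ⟨star_v_mul_v l, v_mul_star_v l⟩

theorem norm_translation (l : EuclideanSpace ℝ (Fin d)) (a : WeylAlgebra d) :
    ‖translation l a‖ = ‖a‖ := by
  rw [translation, CStarRing.norm_mul_mem_unitary _ (Unitary.star_mem (v_mem_unitary l)),
    CStarRing.norm_mem_unitary_mul _ (v_mem_unitary l)]

/-- An element of the Weyl `C^*`-algebra has norm-continuous translates. -/
theorem continuous_translation_left (a : WeylAlgebra d) :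
    Continuous (fun l => translation l a) := by
  have hdense : ∀ b : WeylStarAlgebra d, Continuous (fun l => translation l (of b)) := by
    intro b
    induction b using WeylStarAlgebra.induction_mono with
    | h0 =>
      have h : ∀ l : EuclideanSpace ℝ (Fin d),
          translation l (of (0 : WeylStarAlgebra d)) = 0 := fun l => by
        rw [← norm_eq_zero, norm_translation, norm_of, norm_zero]
      simp only [h]
      exact continuous_const
    | hadd b b' h h' =>
      simp only [of_add, translation_add]
      exact h.add h'
    | hm z c =>
      obtain ⟨α, β⟩ := z
      simp only [translation_of_mono]
      fun_prop
  -- Translations are isometric, so approximating `a` by `b` approximates the whole orbit uniformly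
  -- in `l`.
  refine continuous_of_uniform_approx_of_continuous fun s hs => ?_
  obtain ⟨ε, hε, hεs⟩ := Metric.mem_uniformity_dist.1 hs
  obtain ⟨b, hb⟩ := denseRange_of.exists_dist_lt a hε
  refine ⟨_, hdense b, fun l => hεs ?_⟩
  rwa [dist_eq_norm, ← translation_sub, norm_translation, ← dist_eq_norm]

/-! ### Cubes -/

theorem preimage_toLp_cube (L : ℝ) :
    (WithLp.toLp 2 : (Fin d → ℝ) → EuclideanSpace ℝ (Fin d)) ⁻¹' cube d L
      = Set.univ.pi fun _ => Set.Icc (-L) L := by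
  ext x
  simp only [cube, Set.mem_preimage, Set.mem_ofPred_eq, Set.mem_univ_pi]

theorem isCompact_cube (L : ℝ) : IsCompact (cube d L) := by
  have h : cube d L = (WithLp.toLp 2 : (Fin d → ℝ) → EuclideanSpace ℝ (Fin d)) ''
      Set.univ.pi fun _ => Set.Icc (-L) L := by
    rw [← preimage_toLp_cube, Set.image_preimage_eq _ (WithLp.toLp_surjective 2)]
  rw [h]
  exact (isCompact_univ_pi fun _ => isCompact_Icc).image (PiLp.continuous_toLp 2 _)

theorem integrableOn_translation (a : WeylAlgebra d) (L : ℝ) :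
    IntegrableOn (fun l => translation l a) (cube d L) :=
  (continuous_translation_left a).continuousOn.integrableOn_compact (isCompact_cube L)

/-- Fubini, after a volume-preserving passage to `Fin d → ℝ`, where the cube is a product of
intervals. -/
theorem setIntegral_cube_prod (L : ℝ) (f : Fin d → ℝ → ℂ) :
    ∫ l in cube d L, ∏ i, f i (l i) = ∏ i, ∫ x in Set.Icc (-L) L, f i x := by
  rw [← (PiLp.volume_preserving_toLp (Fin d)).setIntegral_preimage_emb
    (MeasurableEquiv.toLp 2 (Fin d → ℝ)).measurableEmbedding, preimage_toLp_cube, volume_pi,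
    Measure.restrict_pi_pi]
  exact integral_fintype_prod_eq_prod f

theorem volume_real_cube {L : ℝ} (hL : 0 ≤ L) : volume.real (cube d L) = (2 * L) ^ d := by
  rw [measureReal_def, ← (PiLp.volume_preserving_toLp (Fin d)).measure_preimage
    (isCompact_cube L).measurableSet.nullMeasurableSet, preimage_toLp_cube,
    volume_pi_pi, ENNReal.toReal_prod]
  have h : 0 ≤ L + L := by linarith
  simp [h, two_mul]

/-! ### Means of characters over cubes -/

theorem tendsto_mean_exp (s : ℝ) :
    Tendsto (fun L : ℝ => ((2 * L : ℝ) : ℂ)⁻¹ *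
      ∫ x in Set.Icc (-L) L, Complex.exp (-(Complex.I * ((s * x : ℝ) : ℂ)))) atTop
      (𝓝 (if s = 0 then 1 else 0)) := by
  split_ifs with hs
  · refine tendsto_const_nhds.congr' ?_
    filter_upwards [eventually_gt_atTop 0] with L hL
    have h : 0 ≤ L + L := by linarith
    have h0 : ((2 * L : ℝ) : ℂ) ≠ 0 := by exact_mod_cast (by positivity : 2 * L ≠ 0)
    have hv : volume.real (Set.Icc (-L) L) = 2 * L := by
      simp [measureReal_def, h, two_mul]
    simp only [hs, zero_mul, Complex.ofReal_zero, mul_zero, neg_zero, Complex.exp_zero,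
      setIntegral_const, hv]
    rw [Complex.real_smul, mul_one, inv_mul_cancel₀ h0]
  · have hc : -(Complex.I * (s : ℂ)) ≠ 0 := by simpa using hs
    -- The antiderivative has denominator of modulus `|s|` and a numerator of modulus one at each
    -- endpoint, so the integral is at most `2 / |s|` for every `L`.
    refine squeeze_zero_norm' (a := fun L : ℝ => (2 * L)⁻¹ * (2 / |s|)) ?_ ?_
    · filter_upwards [eventually_gt_atTop 0] with L hL
      have hL' : -L ≤ L := by linarith
      rw [norm_mul, norm_inv, Complex.norm_real, Real.norm_of_nonneg (by positivity),
        integral_Icc_eq_integral_Ioc, ← intervalIntegral.integral_of_le hL']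
      refine mul_le_mul_of_nonneg_left ?_ (by positivity)
      have h : ∀ x : ℝ, -(Complex.I * ((s * x : ℝ) : ℂ)) = -(Complex.I * (s : ℂ)) * x := by
        intro x
        push_cast
        ring
      simp only [h]
      rw [integral_exp_mul_complex hc, norm_div, norm_neg, norm_mul, Complex.norm_I, one_mul,
        Complex.norm_real, Real.norm_eq_abs]
      refine div_le_div_of_nonneg_right ((norm_sub_le _ _).trans ?_) (abs_nonneg s)
      rw [Complex.norm_exp, Complex.norm_exp]
      simp
      norm_num
    · have h : Tendsto (fun L : ℝ => 2 * L) atTop atTop :=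
        tendsto_id.const_mul_atTop (by norm_num)
      simpa using h.inv_tendsto_atTop.mul_const (2 / |s|)

/-- The character factors over the coordinates, and a single nonzero coordinate of `α` sends the
product of means to zero. -/
theorem tendsto_mean_exp_inner (α : EuclideanSpace ℝ (Fin d)) :
    Tendsto (fun L : ℝ => (((2 * L) ^ d : ℝ) : ℂ)⁻¹ *
      ∫ l in cube d L, Complex.exp (-(Complex.I * ((inner ℝ α l : ℝ) : ℂ)))) atTop
      (𝓝 (if α = 0 then 1 else 0)) := by
  have h : ∀ l : EuclideanSpace ℝ (Fin d), Complex.exp (-(Complex.I * ((inner ℝ α l : ℝ) : ℂ)))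
      = ∏ i, Complex.exp (-(Complex.I * ((α i * l i : ℝ) : ℂ))) := by
    intro l
    rw [← Complex.exp_sum, PiLp.inner_apply]
    congr 1
    simp [Finset.mul_sum, mul_comm]
  have hlim := tendsto_finsetProd Finset.univ fun i _ => tendsto_mean_exp (α i)
  have hval : (∏ i, if α i = 0 then (1 : ℂ) else 0) = if α = 0 then 1 else 0 := by
    rw [Finset.prod_ite_zero]
    simp [PiLp.ext_iff]
  rw [hval] at hlim
  refine hlim.congr fun L => ?_
  simp only [h]
  rw [setIntegral_cube_prod L fun i x => Complex.exp (-(Complex.I * ((α i * x : ℝ) : ℂ))),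
    Finset.prod_mul_distrib, Finset.prod_const, Finset.card_univ, Fintype.card_fin, inv_pow,
    Complex.ofReal_pow]

/-! ### Ergodic means -/

theorem cubeMean_add (L : ℝ) (a b : WeylAlgebra d) :
    cubeMean L (a + b) = cubeMean L a + cubeMean L b := by
  simp only [cubeMean, translation_add]
  rw [integral_add (integrableOn_translation a L) (integrableOn_translation b L), smul_add]

theorem cubeMean_smul (L : ℝ) (c : ℂ) (a : WeylAlgebra d) :
    cubeMean L (c • a) = c • cubeMean L a := by
  simp only [cubeMean, translation_smul]
  rw [integral_smul, smul_comm]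

theorem cubeMean_sub (L : ℝ) (a b : WeylAlgebra d) :
    cubeMean L (a - b) = cubeMean L a - cubeMean L b := by
  have h := cubeMean_add L (a - b) b
  rw [sub_add_cancel] at h
  exact eq_sub_of_add_eq h.symm

/-- This bound, uniform in `L`, carries convergence from a dense subset to the whole algebra. -/
theorem norm_cubeMean_le {L : ℝ} (hL : 0 < L) (a : WeylAlgebra d) : ‖cubeMean L a‖ ≤ ‖a‖ := by
  have hpos : 0 < (2 * L) ^ d := by positivity
  have h : ‖∫ l in cube d L, translation l a‖ ≤ ‖a‖ * (2 * L) ^ d := by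
    rw [← volume_real_cube hL.le]
    exact norm_setIntegral_le_of_norm_le_const (isCompact_cube L).measure_lt_top
      fun l _ => (norm_translation l a).le
  rw [cubeMean, norm_smul, norm_inv, Real.norm_of_nonneg hpos.le, inv_mul_le_iff₀ hpos, mul_comm]
  exact h

theorem cubeMean_of_invariant {L : ℝ} (hL : 0 < L) {a : WeylAlgebra d}
    (ha : ∀ l, translation l a = a) : cubeMean L a = a := by
  have hpos : (2 * L) ^ d ≠ 0 := by positivity
  simp only [cubeMean, ha]
  rw [setIntegral_const, volume_real_cube hL.le, smul_smul, inv_mul_cancel₀ hpos, one_smul]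

theorem tendsto_cubeMean_of_mono (α β : EuclideanSpace ℝ (Fin d)) (c : ℂ) :
    Tendsto (fun L : ℝ => cubeMean L (of (WeylStarAlgebra.mono (α, β) c))) atTop
      (𝓝 (if α = 0 then of (WeylStarAlgebra.mono (α, β) c) else 0)) := by
  have h := (tendsto_mean_exp_inner α).smul_const (of (WeylStarAlgebra.mono (α, β) c))
  rw [ite_smul, one_smul, zero_smul] at h
  refine h.congr fun L => ?_
  simp only [cubeMean, translation_of_mono]
  rw [integral_smul_const, mul_smul, ← Complex.ofReal_inv, Complex.coe_smul]

theorem exists_tendsto_cubeMean_of (b : WeylStarAlgebra d) :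
    ∃ m, Tendsto (fun L : ℝ => cubeMean L (of b)) atTop (𝓝 m) := by
  induction b using WeylStarAlgebra.induction_mono with
  | h0 =>
    rw [← WeylStarAlgebra.mono_zero (0, 0)]
    exact ⟨_, tendsto_cubeMean_of_mono _ _ _⟩
  | hadd b b' h h' =>
    obtain ⟨m, hm⟩ := h
    obtain ⟨m', hm'⟩ := h'
    simp only [of_add, cubeMean_add]
    exact ⟨_, hm.add hm'⟩
  | hm z c => exact ⟨_, tendsto_cubeMean_of_mono z.1 z.2 c⟩

theorem exists_tendsto_cubeMean (a : WeylAlgebra d) :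
    ∃ m, Tendsto (fun L : ℝ => cubeMean L a) atTop (𝓝 m) := by
  rw [← cauchy_map_iff_exists_tendsto, Metric.cauchy_iff]
  refine ⟨inferInstance, fun ε hε => ?_⟩
  -- One quarter of `ε` pays for replacing `a` by `b`, another for the convergence of the means of
  -- `b`. All late means of `a` then lie in a ball of radius `ε / 2`.
  obtain ⟨b, hb⟩ := denseRange_of.exists_dist_lt a (by positivity : 0 < ε / 4)
  obtain ⟨m, hm⟩ := exists_tendsto_cubeMean_of b
  have hev : ∀ᶠ L : ℝ in atTop, dist (cubeMean L a) m < ε / 2 := by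
    filter_upwards [eventually_gt_atTop 0, hm.eventually (Metric.ball_mem_nhds m
      (by positivity : 0 < ε / 4))] with L hL hLm
    have h1 : dist (cubeMean L a) (cubeMean L (of b)) < ε / 4 := by
      rw [dist_eq_norm, ← cubeMean_sub]
      exact (norm_cubeMean_le hL _).trans_lt (by rwa [← dist_eq_norm])
    have h2 : dist (cubeMean L (of b)) m < ε / 4 := hLm
    linarith [dist_triangle (cubeMean L a) (cubeMean L (of b)) m]
  refine ⟨Metric.ball m (ε / 2), hev, fun x hx y hy => ?_⟩
  have h1 : dist x m < ε / 2 := hx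
  have h2 : dist y m < ε / 2 := hy
  linarith [dist_triangle_right x y m]

theorem tendsto_cubeMean (a : WeylAlgebra d) :
    Tendsto (fun L : ℝ => cubeMean L a) atTop (𝓝 (ergodicMean a)) :=
  tendsto_nhds_limUnder (exists_tendsto_cubeMean a)

theorem ergodicMean_add (a b : WeylAlgebra d) :
    ergodicMean (a + b) = ergodicMean a + ergodicMean b := by
  refine tendsto_nhds_unique (tendsto_cubeMean (a + b)) ?_
  simp only [cubeMean_add]
  exact (tendsto_cubeMean a).add (tendsto_cubeMean b)

theorem ergodicMean_smul (c : ℂ) (a : WeylAlgebra d) :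
    ergodicMean (c • a) = c • ergodicMean a := by
  refine tendsto_nhds_unique (tendsto_cubeMean (c • a)) ?_
  simp only [cubeMean_smul]
  exact (tendsto_cubeMean a).const_smul c

theorem norm_ergodicMean_le (a : WeylAlgebra d) : ‖ergodicMean a‖ ≤ ‖a‖ := by
  refine le_of_tendsto (tendsto_cubeMean a).norm ?_
  filter_upwards [eventually_gt_atTop 0] with L hL using norm_cubeMean_le hL a

theorem ergodicMean_of_invariant {a : WeylAlgebra d} (ha : ∀ l, translation l a = a) :
    ergodicMean a = a := by
  refine tendsto_nhds_unique (tendsto_cubeMean a) (tendsto_const_nhds.congr' ?_)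
  filter_upwards [eventually_gt_atTop 0] with L hL using (cubeMean_of_invariant hL ha).symm

theorem ergodicMean_of_mono (α β : EuclideanSpace ℝ (Fin d)) (c : ℂ) :
    ergodicMean (of (WeylStarAlgebra.mono (α, β) c))
      = if α = 0 then of (WeylStarAlgebra.mono (α, β) c) else 0 :=
  tendsto_nhds_unique (tendsto_cubeMean _) (tendsto_cubeMean_of_mono α β c)

/-- The ergodic mean as a bounded operator. -/
noncomputable def ergodicMeanL (d : ℕ) : WeylAlgebra d →L[ℂ] WeylAlgebra d :=
  LinearMap.mkContinuous
    { toFun := ergodicMean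
      map_add' := ergodicMean_add
      map_smul' := ergodicMean_smul } 1 fun a => by
        rw [one_mul]
        exact norm_ergodicMean_le a

theorem continuous_ergodicMean : Continuous (ergodicMean : WeylAlgebra d → WeylAlgebra d) :=
  (ergodicMeanL d).continuous

theorem ergodicMean_sum {ι : Type} (s : Finset ι) (f : ι → WeylAlgebra d) :
    ergodicMean (∑ i ∈ s, f i) = ∑ i ∈ s, ergodicMean (f i) :=
  map_sum (ergodicMeanL d) f s

/-! ### The subalgebra generated by the `v_β` -/

theorem v_mem_subalgV (β : EuclideanSpace ℝ (Fin d)) : v β ∈ subalgV d :=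
  StarSubalgebra.le_topologicalClosure _ (StarAlgebra.subset_adjoin ℂ _ ⟨β, rfl⟩)

theorem isClosed_subalgV : IsClosed (subalgV d : Set (WeylAlgebra d)) :=
  StarSubalgebra.isClosed_topologicalClosure _

/-- The centralizer is a closed star-subalgebra and contains the mutually commuting generators, so
it contains the closure they generate. -/
theorem subalgV_le_centralizer :
    subalgV d ≤ StarSubalgebra.centralizer ℂ
      (Set.range (v : EuclideanSpace ℝ (Fin d) → WeylAlgebra d)) := by
  refine StarSubalgebra.topologicalClosure_minimal (StarAlgebra.adjoin_le ?_) ?_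
  · rintro _ ⟨β, rfl⟩
    rw [SetLike.mem_coe, StarSubalgebra.mem_centralizer_iff]
    rintro _ ⟨γ, rfl⟩
    simp only [star_v, v_mul_v, add_comm, and_self]
  · rw [StarSubalgebra.coe_centralizer]
    exact Set.isClosed_centralizer _

theorem commute_v {b : WeylAlgebra d} (hb : b ∈ subalgV d) (l : EuclideanSpace ℝ (Fin d)) :
    Commute (v l) b :=
  ((StarSubalgebra.mem_centralizer_iff ℂ).1 (subalgV_le_centralizer hb) _ ⟨l, rfl⟩).1

theorem translation_of_mem_subalgV (l : EuclideanSpace ℝ (Fin d)) {b : WeylAlgebra d}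
    (hb : b ∈ subalgV d) : translation l b = b := by
  rw [translation, (commute_v hb l).eq, mul_assoc, v_mul_star_v, mul_one]

theorem ergodicMean_of_mem_subalgV {b : WeylAlgebra d} (hb : b ∈ subalgV d) :
    ergodicMean b = b :=
  ergodicMean_of_invariant fun l => translation_of_mem_subalgV l hb

theorem of_mono_zero_left (β : EuclideanSpace ℝ (Fin d)) (c : ℂ) :
    of (WeylStarAlgebra.mono (0, β) c) = c • v β := by
  rw [v, ← of_smul, WeylStarAlgebra.smul_mono, mul_one]

/-- Averaging leaves only multiples of the `v_β` on the dense subalgebra; `𝕍` is closed and the mean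
is continuous. -/
theorem ergodicMean_mem_subalgV (a : WeylAlgebra d) : ergodicMean a ∈ subalgV d := by
  induction a using induction_of with
  | hc => exact isClosed_subalgV.preimage continuous_ergodicMean
  | h b =>
    induction b using WeylStarAlgebra.induction_mono with
    | h0 =>
      rw [← WeylStarAlgebra.mono_zero (0, 0), of_mono_zero_left, zero_smul,
        ergodicMean_of_mem_subalgV (zero_mem _)]
      exact zero_mem _
    | hadd b b' h h' =>
      rw [of_add, ergodicMean_add]
      exact add_mem h h'
    | hm z c =>
      obtain ⟨α, β⟩ := z
      rw [ergodicMean_of_mono]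
      split_ifs with hα
      · rw [hα, of_mono_zero_left]
        exact SMulMemClass.smul_mem c (v_mem_subalgV β)
      · exact zero_mem _

/-! ### The ergodic mean as a conditional expectation: bimodule property and positivity -/

theorem translation_mul (l : EuclideanSpace ℝ (Fin d)) (a b : WeylAlgebra d) :
    translation l (a * b) = translation l a * translation l b := by
  simp only [translation, mul_assoc]
  rw [← mul_assoc (star (v l)) (v l), star_v_mul_v, one_mul]

/-- Elements of `𝕍` are fixed by translations, so they come out of the integral as constants. -/
theorem ergodicMean_mul_right (a : WeylAlgebra d) {b : WeylAlgebra d} (hb : b ∈ subalgV d) :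
    ergodicMean (a * b) = ergodicMean a * b := by
  refine tendsto_nhds_unique (tendsto_cubeMean (a * b))
    (((tendsto_cubeMean a).mul_const b).congr fun L => ?_)
  simp only [cubeMean, translation_mul, translation_of_mem_subalgV _ hb]
  rw [smul_mul_assoc]
  congr 1
  exact (ContinuousLinearMap.integral_comp_comm
    ((ContinuousLinearMap.mul ℝ (WeylAlgebra d)).flip b) (integrableOn_translation a L)).symm

theorem ergodicMean_mul_left (a : WeylAlgebra d) {b : WeylAlgebra d} (hb : b ∈ subalgV d) :
    ergodicMean (b * a) = b * ergodicMean a := by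
  refine tendsto_nhds_unique (tendsto_cubeMean (b * a))
    (((tendsto_cubeMean a).const_mul b).congr fun L => ?_)
  simp only [cubeMean, translation_mul, translation_of_mem_subalgV _ hb]
  rw [mul_smul_comm]
  congr 1
  exact (ContinuousLinearMap.integral_comp_comm
    (ContinuousLinearMap.mul ℝ (WeylAlgebra d) b) (integrableOn_translation a L)).symm

/-- Orthonormality of the `u_α` for the `𝕍`-valued inner product `⟨x^* y⟩`. -/
theorem ergodicMean_star_u_mul_u (α α' : EuclideanSpace ℝ (Fin d)) :
    ergodicMean (star (u α) * u α') = if α = α' then 1 else 0 := by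
  have h : star (u α) * u α' = of (WeylStarAlgebra.mono (α' - α, 0) 1) := by
    rw [u, u, star_of, WeylStarAlgebra.star_mono, of_mono_mul_of_mono]
    simp [WeylStarAlgebra.phase, sub_eq_neg_add]
  rw [h, ergodicMean_of_mono]
  by_cases hα : α = α'
  · simp only [hα, sub_self, if_true]
    rfl
  · rw [if_neg hα, if_neg (sub_ne_zero.2 (Ne.symm hα))]

/-- The elements of the Weyl `*`-algebra are finite sums `∑ u_α b_α` with coefficients `b_α`
in `𝕍`. -/
theorem exists_sum_u_mul (a : WeylStarAlgebra d) :
    ∃ f : EuclideanSpace ℝ (Fin d) →₀ subalgV d,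
      of a = f.sum fun α b => u α * (b : WeylAlgebra d) := by
  induction a using WeylStarAlgebra.induction_mono with
  | h0 =>
    refine ⟨0, ?_⟩
    rw [Finsupp.sum_zero_index, ← WeylStarAlgebra.mono_zero (0, 0), of_mono_zero_left, zero_smul]
  | hadd a a' h h' =>
    obtain ⟨f, hf⟩ := h
    obtain ⟨f', hf'⟩ := h'
    refine ⟨f + f', ?_⟩
    rw [of_add, hf, hf', Finsupp.sum_add_index'] <;> simp [mul_add]
  | hm z c =>
    obtain ⟨α, β⟩ := z
    refine ⟨Finsupp.single α (c • ⟨v β, v_mem_subalgV β⟩), ?_⟩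
    rw [Finsupp.sum_single_index (by simp)]
    change _ = u α * (c • v β)
    rw [mul_smul_comm, u, of_mono_mul_v, ← of_smul, WeylStarAlgebra.smul_mono, mul_one, zero_add]

/-- Parseval's identity. The squares are those of elements of `𝕍` itself, so positivity of a state
of `𝕍` applies to them directly. -/
theorem ergodicMean_star_mul_self (f : EuclideanSpace ℝ (Fin d) →₀ subalgV d) :
    ergodicMean (star (f.sum fun α b => u α * (b : WeylAlgebra d)) *
        f.sum fun α b => u α * (b : WeylAlgebra d))
      = ∑ α ∈ f.support, star (f α : WeylAlgebra d) * (f α : WeylAlgebra d) := by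
  have h : ∀ α α', ergodicMean (star (u α * (f α : WeylAlgebra d)) * (u α' * (f α' : WeylAlgebra d)))
      = if α = α' then star (f α : WeylAlgebra d) * (f α' : WeylAlgebra d) else 0 := by
    intro α α'
    rw [star_mul, mul_assoc, ergodicMean_mul_left _ (star_mem (f α).2), ← mul_assoc (star (u α)),
      ergodicMean_mul_right _ (f α').2, ergodicMean_star_u_mul_u]
    split_ifs <;> simp
  simp only [Finsupp.sum, star_sum, Finset.sum_mul_sum, ergodicMean_sum, h]
  refine Finset.sum_congr rfl fun α hα => ?_
  rw [Finset.sum_ite_eq, if_pos hα]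

/-- The ergodic mean as a bounded operator with values in `𝕍`. -/
noncomputable def expectation (d : ℕ) : WeylAlgebra d →L[ℂ] subalgV d where
  toFun a := ⟨ergodicMean a, ergodicMean_mem_subalgV a⟩
  map_add' a b := Subtype.ext (ergodicMean_add a b)
  map_smul' c a := Subtype.ext (ergodicMean_smul c a)
  cont := continuous_ergodicMean.subtype_mk _

theorem expectation_coe (b : subalgV d) : expectation d b = b :=
  Subtype.ext (ergodicMean_of_mem_subalgV b.2)

/-- Since `v l` lies in `𝕍`, both conjugating factors leave the mean, and they act trivially on what
remains. -/
theorem expectation_translation (l : EuclideanSpace ℝ (Fin d)) (a : WeylAlgebra d) :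
    expectation d (translation l a) = expectation d a := by
  refine Subtype.ext ?_
  change ergodicMean (v l * a * star (v l)) = ergodicMean a
  rw [ergodicMean_mul_right _ (star_mem (v_mem_subalgV l)),
    ergodicMean_mul_left _ (v_mem_subalgV l)]
  exact translation_of_mem_subalgV l (ergodicMean_mem_subalgV a)

end WeylAlgebra

/-! ### States of a unital `C^*`-algebra -/

section States

variable {A : Type} [CStarAlgebra A] {ω : WeakDual ℂ A}

/-- Polarization: `ω` is real on the squares of `1 + c • a` and `c • a`. The values `c = 1` and `c =
i` fix the imaginary and real parts. -/
theorem map_star_of_mem_stateSpace (hω : ω ∈ stateSpace A) (a : A) :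
    ω (star a) = starRingEnd ℂ (ω a) := by
  have h : ∀ c : ℂ, (c * ω a + starRingEnd ℂ c * ω (star a)).im = 0 := by
    intro c
    have h1 := (Complex.nonneg_iff.1 (hω.2 (1 + c • a))).2
    have h2 := (Complex.nonneg_iff.1 (hω.2 (c • a))).2
    have h3 : star (1 + c • a) * (1 + c • a)
        = 1 + (c • a + starRingEnd ℂ c • star a) + star (c • a) * (c • a) := by
      rw [star_add, star_one, add_mul, mul_add, mul_add, one_mul, one_mul, mul_one, star_smul]
      simp only [starRingEnd_apply]
      abel
    rw [h3, map_add, map_add, map_add, map_smul, map_smul, hω.1] at h1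
    simp only [Complex.add_im, Complex.one_im, smul_eq_mul] at h1 ⊢
    linarith
  have h1 := h 1
  have h2 := h Complex.I
  simp at h1 h2
  apply Complex.ext
  · simp
    linarith
  · simp
    linarith

/-- Degenerate Cauchy–Schwarz: positivity on `y - t w̄ x`, with `w = ω (y^* x)`, has no term
quadratic in `t`, so the linear term `-2 t |w|²` must vanish. -/
theorem map_star_mul_eq_zero (hω : ω ∈ stateSpace A) {x : A} (hx : ω (star x * x) = 0) (y : A) :
    ω (star y * x) = 0 := by
  set w := ω (star y * x) with hw
  have hw' : ω (star x * y) = starRingEnd ℂ w := by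
    rw [hw, ← map_star_of_mem_stateSpace hω, star_mul, star_star]
  have h : ∀ t : ℝ, 0 ≤ (ω (star y * y)).re - 2 * t * Complex.normSq w := by
    intro t
    have h1 := (Complex.nonneg_iff.1 (hω.2 (y + (-(t * starRingEnd ℂ w)) • x))).1
    have h2 : star (y + (-(t * starRingEnd ℂ w)) • x) * (y + (-(t * starRingEnd ℂ w)) • x)
        = star y * y + (-(t * starRingEnd ℂ w)) • (star y * x) + (-(t * w)) • (star x * y)
          + ((t * w) * (t * starRingEnd ℂ w)) • (star x * x) := by
      rw [star_add, star_smul, add_mul, mul_add, mul_add, smul_mul_smul_comm, smul_mul_assoc,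
        mul_smul_comm]
      simp only [star_neg, star_mul', Complex.star_def, Complex.conj_ofReal, Complex.conj_conj,
        neg_mul_neg]
      abel
    rw [h2, map_add, map_add, map_add, map_smul, map_smul, map_smul, hx, hw', ← hw, smul_zero,
      add_zero] at h1
    simp [Complex.normSq_apply] at h1 ⊢
    linarith
  by_contra hne
  have hpos : 0 < Complex.normSq w := Complex.normSq_pos.2 hne
  -- This `t` makes the nonnegative expression equal to `-1`.
  have h1 := h (((ω (star y * y)).re + 1) / (2 * Complex.normSq w))
  have h2 : 2 * (((ω (star y * y)).re + 1) / (2 * Complex.normSq w)) * Complex.normSq w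
      = (ω (star y * y)).re + 1 := by
    field_simp
  linarith

/-- A unitary on which a state has modulus one belongs to the multiplicative domain of the
state. -/
theorem map_conj_unitary (hω : ω ∈ stateSpace A) {U : A} (hU : U ∈ unitary A)
    (h : starRingEnd ℂ (ω U) * ω U = 1) (a : A) : ω (U * a * star U) = ω a := by
  -- The value is `1 - |ω U|²`. Cauchy–Schwarz against this null vector lets `U^*` be replaced by
  -- the scalar `conj (ω U)` on the right; taking adjoints handles `U` on the left.
  have hnull : ω (star (star U - starRingEnd ℂ (ω U) • (1 : A)) *
      (star U - starRingEnd ℂ (ω U) • (1 : A))) = 0 := by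
    rw [star_sub, star_star, star_smul, star_one, sub_mul, mul_sub, mul_sub, hU.2,
      smul_mul_smul_comm, mul_smul_comm, smul_mul_assoc, one_mul, mul_one, mul_one]
    simp only [map_sub, map_smul, hω.1, map_star_of_mem_stateSpace hω, Complex.star_def,
      Complex.conj_conj, smul_eq_mul]
    linear_combination -h
  have hright : ∀ b, ω (b * star U) = starRingEnd ℂ (ω U) * ω b := by
    intro b
    have h1 := map_star_mul_eq_zero hω hnull (star b)
    rw [star_star, mul_sub, map_sub, mul_smul_comm, mul_one, map_smul, smul_eq_mul] at h1
    exact sub_eq_zero.1 h1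
  have hleft : ω (U * a) = ω U * ω a := by
    have h1 : U * a = star (star a * star U) := by rw [star_mul, star_star, star_star]
    rw [h1, map_star_of_mem_stateSpace hω, hright, map_star_of_mem_stateSpace hω, map_mul,
      Complex.conj_conj, Complex.conj_conj]
  rw [hright, hleft, ← mul_assoc, h, one_mul]

/-- A pure state is multiplicative with respect to elements which split it into positive
functionals. -/
theorem map_mul_of_mem_pureStates (hω : ω ∈ pureStates A) {h : A} {s : ℝ} (hs : 0 < s)
    (hs' : s < 1) (hh : ω h = s) (hpos : ∀ a, 0 ≤ ω (star a * a * h))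
    (hpos' : ∀ a, 0 ≤ ω (star a * a * (1 - h))) (a : A) : ω (a * h) = ω a * ω h := by
  -- Normalizing `ω (· h)` and `ω (· (1 - h))` gives two states whose convex combination with
  -- weights `s` and `1 - s` is `ω`. Extremality forces the first to equal `ω`.
  have key : ∀ (k : A) (r : ℝ), 0 < r → ω k = r → (∀ a, 0 ≤ ω (star a * a * k)) →
      ∃ φ ∈ stateSpace A, ∀ a, φ a = (r : ℂ)⁻¹ * ω (a * k) := by
    intro k r hr hk hp
    refine ⟨StrongDual.toWeakDual ((r : ℂ)⁻¹ •
      (WeakDual.toStrongDual ω).comp ((ContinuousLinearMap.mul ℂ A).flip k)), ⟨?_, ?_⟩,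
      fun a => rfl⟩
    · change (r : ℂ)⁻¹ * ω (1 * k) = 1
      rw [one_mul, hk, inv_mul_cancel₀ (by exact_mod_cast hr.ne')]
    · intro a
      change 0 ≤ (r : ℂ)⁻¹ * ω (star a * a * k)
      refine mul_nonneg ?_ (hp a)
      rw [← Complex.ofReal_inv]
      exact_mod_cast (inv_pos.2 hr).le
  obtain ⟨φ, hφ, hφa⟩ := key h s hs hh hpos
  obtain ⟨ψ, hψ, hψa⟩ := key (1 - h) (1 - s) (by linarith)
    (by rw [map_sub, hω.1.1, hh]; push_cast; rfl) hpos'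
  have h1 : (s : ℂ) ≠ 0 := by exact_mod_cast hs.ne'
  have h2 : ((1 - s : ℝ) : ℂ) ≠ 0 := by exact_mod_cast (by linarith : (1 - s : ℝ) ≠ 0)
  have hseg : ω ∈ openSegment ℝ φ ψ := by
    refine ⟨s, 1 - s, hs, by linarith, by ring, DFunLike.ext _ _ fun b => ?_⟩
    change (s : ℂ) * φ b + ((1 - s : ℝ) : ℂ) * ψ b = ω b
    rw [hφa, hψa, mul_inv_cancel_left₀ h1, mul_inv_cancel_left₀ h2, ← map_add, ← mul_add,
      add_sub_cancel, mul_one]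
  have heq : φ = ω := (mem_extremePoints_iff_left.1 hω).2 φ hφ ψ hψ hseg
  have h3 := hφa a
  rw [heq] at h3
  rw [h3, hh, mul_right_comm, inv_mul_cancel₀ h1, one_mul]

/-- A pure state has modulus one on every central unitary. -/
theorem conj_mul_self_of_mem_pureStates (hω : ω ∈ pureStates A) {U : A} (hU : U ∈ unitary A)
    (hc : ∀ a, Commute U a) : starRingEnd ℂ (ω U) * ω U = 1 := by
  have hc' : ∀ a, Commute (star U) a := fun a => by
    simpa using (hc (star a)).star_star
  -- For `|c| = 1`, `h c = 1/4 + (1/8) (1 + c U)^* (1 + c U)` is central and visibly positive, and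
  -- `1 - h c = h (-c)` is of the same kind. So `ω (h c)` lies between `1/4` and `3/4`, strictly
  -- inside `(0, 1)` as the splitting of a pure state requires.
  set h : ℂ → A := fun c => (1 / 2 : ℂ) • (1 : A) +
    (1 / 8 : ℂ) • (c • U + starRingEnd ℂ c • star U) with hdef
  have hval : ∀ c, starRingEnd ℂ c * c = 1 → ∀ a,
      star a * a * h c = (1 / 8 : ℂ) • (star (a * (1 + c • U)) * (a * (1 + c • U)))
        + (1 / 4 : ℂ) • (star a * a) := by
    intro c hcc a
    have h1 : star (1 + c • U) * (star a * a) = star a * a * star (1 + c • U) := by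
      rw [star_add, star_one, star_smul]
      exact (((Commute.one_left _).add_left ((hc' _).smul_left _))).eq
    have h2 : star (1 + c • U) * (1 + c • U)
        = (2 : ℂ) • (1 : A) + (c • U + starRingEnd ℂ c • star U) := by
      rw [star_add, star_one, star_smul, add_mul, mul_add, mul_add, one_mul, one_mul, mul_one,
        smul_mul_smul_comm, hU.1]
      simp only [← starRingEnd_apply, hcc]
      module
    have h3 : star (a * (1 + c • U)) * (a * (1 + c • U))
        = star a * a * (star (1 + c • U) * (1 + c • U)) := by
      rw [star_mul, ← mul_assoc (star a * a), ← h1]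
      simp only [mul_assoc]
    rw [h3, h2, hdef]
    simp only [mul_add, mul_smul_comm, mul_one]
    module
  have h8 : (0 : ℂ) ≤ 1 / 8 := by norm_num [Complex.nonneg_iff]
  have h4 : (0 : ℂ) ≤ 1 / 4 := by norm_num [Complex.nonneg_iff]
  have hnonneg : ∀ c, starRingEnd ℂ c * c = 1 → ∀ a, 0 ≤ ω (star a * a * h c) := by
    intro c hcc a
    rw [hval c hcc, map_add, map_smul, map_smul]
    exact add_nonneg (mul_nonneg h8 (hω.1.2 _)) (mul_nonneg h4 (hω.1.2 _))
  have hlower : ∀ c, starRingEnd ℂ c * c = 1 → 1 / 4 ≤ ω (h c) := by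
    intro c hcc
    have h1 := hval c hcc 1
    rw [star_one, one_mul, one_mul, one_mul] at h1
    rw [h1, map_add, map_smul, map_smul, hω.1.1, smul_eq_mul, smul_eq_mul, mul_one]
    exact le_add_of_nonneg_left (mul_nonneg h8 (hω.1.2 _))
  have hneg : ∀ c, 1 - h c = h (-c) := by
    intro c
    simp only [hdef, map_neg]
    module
  have hmul : ∀ c, starRingEnd ℂ c * c = 1 → ∀ a, ω (a * h c) = ω a * ω (h c) := by
    intro c hcc
    have hcc' : starRingEnd ℂ (-c) * (-c) = 1 := by rw [map_neg, neg_mul_neg, hcc]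
    have h1 := Complex.le_def.1 (hlower c hcc)
    have h2 := Complex.le_def.1 (hlower (-c) hcc')
    rw [← hneg, map_sub, hω.1.1] at h2
    norm_num at h1 h2
    refine map_mul_of_mem_pureStates hω (s := (ω (h c)).re) (by linarith) (by linarith)
      (Complex.ext rfl h1.2.symm) (hnonneg c hcc) ?_
    rw [hneg]
    exact hnonneg (-c) hcc'
  have hk : ∀ c, starRingEnd ℂ c * c = 1 → ∀ a,
      c * ω (a * U) + starRingEnd ℂ c * ω (a * star U)
        = ω a * (c * ω U + starRingEnd ℂ c * ω (star U)) := by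
    intro c hcc a
    have h1 := hmul c hcc a
    simp only [hdef, mul_add, mul_smul_comm, mul_one, map_add, map_smul, smul_eq_mul, hω.1.1]
      at h1
    linear_combination 8 * h1
  -- Subtracting `i` times the identity for `c = i` from that for `c = 1` cancels `U^* U^*` and
  -- leaves `ω (U^*) ω (U) = 1`.
  have h1 := hk 1 (by simp) (star U)
  have h2 := hk Complex.I (by simp) (star U)
  simp only [map_one, one_mul, Complex.conj_I, hU.1, hω.1.1] at h1 h2
  rw [← map_star_of_mem_stateSpace hω.1]
  have hI : Complex.I ^ 2 = -1 := Complex.I_sq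
  linear_combination (-1 / 2 : ℂ) * h1 + (Complex.I / 2) * h2 + (1 / 2 : ℂ) *
    (-1 + ω (star U * star U) + ω (star U) * ω U - ω (star U) * ω (star U)) * hI

end States

/-! ### Invariant states -/

namespace WeylAlgebra

variable {d : ℕ}

/-- The functional `ω ∘ ⟨·⟩` on `𝕎` obtained from a functional `ω` on `𝕍`. -/
noncomputable def extendState (ω : WeakDual ℂ (subalgV d)) : WeakDual ℂ (WeylAlgebra d) :=
  StrongDual.toWeakDual ((WeakDual.toStrongDual ω).comp (expectation d))

theorem extendState_apply (ω : WeakDual ℂ (subalgV d)) (a : WeylAlgebra d) :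
    extendState ω a = ω (expectation d a) := rfl

/-- The inclusion of `𝕍` in `𝕎` as a bounded operator. -/
noncomputable def inclusionV (d : ℕ) : subalgV d →L[ℂ] WeylAlgebra d where
  toLinearMap := (subalgV d).subtype.toLinearMap
  cont := continuous_subtype_val

/-- The restriction to `𝕍` of a functional on `𝕎`. -/
noncomputable def restrictState (ω : WeakDual ℂ (WeylAlgebra d)) : WeakDual ℂ (subalgV d) :=
  StrongDual.toWeakDual ((WeakDual.toStrongDual ω).comp (inclusionV d))

theorem restrictState_apply (ω : WeakDual ℂ (WeylAlgebra d)) (b : subalgV d) :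
    restrictState ω b = ω (b : WeylAlgebra d) := rfl

theorem continuous_extendState :
    Continuous (extendState : WeakDual ℂ (subalgV d) → WeakDual ℂ (WeylAlgebra d)) :=
  WeakDual.continuous_of_continuous_eval fun a => WeakDual.eval_continuous (expectation d a)

theorem continuous_restrictState :
    Continuous (restrictState : WeakDual ℂ (WeylAlgebra d) → WeakDual ℂ (subalgV d)) :=
  WeakDual.continuous_of_continuous_eval fun b => WeakDual.eval_continuous (b : WeylAlgebra d)

theorem restrictState_extendState (ω : WeakDual ℂ (subalgV d)) :
    restrictState (extendState ω) = ω :=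
  DFunLike.ext _ _ fun b => by
    rw [restrictState_apply, extendState_apply, expectation_coe]

/-- Positivity is a closed condition, so it is enough to test it on the dense subalgebra, where
Parseval's identity applies. -/
theorem extendState_mem_invStates {ω : WeakDual ℂ (subalgV d)}
    (hω : ω ∈ stateSpace (subalgV d)) : extendState ω ∈ invStates d := by
  refine ⟨⟨?_, fun a => ?_⟩, fun l a => ?_⟩
  · rw [extendState_apply]
    have h : expectation d 1 = 1 := expectation_coe 1
    rw [h]
    exact hω.1
  · induction a using induction_of with
    | hc =>
      exact isClosed_Ici.preimage ((extendState ω).continuous.comp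
        (continuous_star_aux.mul continuous_id))
    | h a =>
      obtain ⟨f, hf⟩ := exists_sum_u_mul a
      have h : expectation d (star (of a) * of a) = ∑ α ∈ f.support, star (f α) * f α := by
        refine Subtype.ext ?_
        change ergodicMean _ = _
        rw [hf, ergodicMean_star_mul_self]
        exact (map_sum (inclusionV d) (fun α => star (f α) * f α) f.support).symm
      rw [extendState_apply, h, map_sum]
      exact Finset.sum_nonneg fun α _ => hω.2 (f α)
  · rw [extendState_apply, expectation_translation, extendState_apply]

theorem restrictState_mem_stateSpace {ω : WeakDual ℂ (WeylAlgebra d)}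
    (hω : ω ∈ stateSpace (WeylAlgebra d)) : restrictState ω ∈ stateSpace (subalgV d) :=
  ⟨hω.1, fun b => hω.2 (b : WeylAlgebra d)⟩

/-- A translationally invariant functional is determined by its restriction to `𝕍`. -/
theorem extendState_restrictState {ω : WeakDual ℂ (WeylAlgebra d)}
    (hω : ∀ (l : EuclideanSpace ℝ (Fin d)) (a : WeylAlgebra d), ω (translation l a) = ω a) :
    extendState (restrictState ω) = ω := by
  refine DFunLike.ext _ _ fun a => ?_
  change ω (ergodicMean a) = ω a
  -- `ω` passes under the Bochner integral, where its value is constant by invariance, so it takes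
  -- the value `ω a` on every cube mean with `L > 0`.
  have h : Tendsto (fun L : ℝ => ω (cubeMean L a)) atTop (𝓝 (ω (ergodicMean a))) :=
    (ω.continuous.tendsto _).comp (tendsto_cubeMean a)
  refine tendsto_nhds_unique h (tendsto_const_nhds.congr' ?_)
  filter_upwards [eventually_gt_atTop 0] with L hL
  have hpos : (((2 * L) ^ d : ℝ) : ℂ) ≠ 0 := by
    exact_mod_cast (by positivity : (2 * L) ^ d ≠ 0)
  have hint : ω (∫ l in cube d L, translation l a) = ∫ l in cube d L, ω (translation l a) :=
    (ContinuousLinearMap.integral_comp_comm (WeakDual.toStrongDual ω)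
      (integrableOn_translation a L)).symm
  rw [cubeMean, ← Complex.coe_smul, map_smul, hint]
  simp only [hω]
  rw [setIntegral_const, volume_real_cube hL.le, Complex.real_smul, smul_eq_mul,
    Complex.ofReal_inv, inv_mul_cancel_left₀ hpos]

/-! ### Purity under restriction and extension -/

theorem restrictState_openSegment {ω φ ψ : WeakDual ℂ (WeylAlgebra d)}
    (h : ω ∈ openSegment ℝ φ ψ) :
    restrictState ω ∈ openSegment ℝ (restrictState φ) (restrictState ψ) := by
  obtain ⟨s, t, hs, ht, hst, rfl⟩ := h
  exact ⟨s, t, hs, ht, hst, rfl⟩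

theorem extendState_openSegment {ω φ ψ : WeakDual ℂ (subalgV d)}
    (h : ω ∈ openSegment ℝ φ ψ) :
    extendState ω ∈ openSegment ℝ (extendState φ) (extendState ψ) := by
  obtain ⟨s, t, hs, ht, hst, rfl⟩ := h
  exact ⟨s, t, hs, ht, hst, rfl⟩

/-- A decomposition of the restriction extends to a decomposition of `ω`, because `ω` is invariant
and so is the extension of its restriction. -/
theorem restrictState_mem_pureStates {ω : WeakDual ℂ (WeylAlgebra d)}
    (hω : ω ∈ pureInvStates d) : restrictState ω ∈ pureStates (subalgV d) := by
  refine mem_extremePoints_iff_left.2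
    ⟨restrictState_mem_stateSpace hω.1.1, fun φ hφ ψ hψ hseg => ?_⟩
  have h := extendState_openSegment hseg
  rw [extendState_restrictState hω.1.2] at h
  have h1 := (mem_extremePoints_iff_left.1 hω.2).2 _ (extendState_mem_invStates hφ).1 _
    (extendState_mem_invStates hψ).1 h
  rw [← h1, restrictState_extendState]

/-- A state of `𝕎` which restricts to a pure state of `𝕍` is translationally invariant. -/
theorem map_translation_of_restrictState_mem_pureStates {ω : WeakDual ℂ (WeylAlgebra d)}
    (hω : ω ∈ stateSpace (WeylAlgebra d)) (hp : restrictState ω ∈ pureStates (subalgV d))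
    (l : EuclideanSpace ℝ (Fin d)) (a : WeylAlgebra d) : ω (translation l a) = ω a := by
  have hU : (⟨v l, v_mem_subalgV l⟩ : subalgV d) ∈ unitary (subalgV d) :=
    ⟨Subtype.ext (star_v_mul_v l), Subtype.ext (v_mul_star_v l)⟩
  -- `v l` is a central unitary of the commutative algebra `𝕍`, so purity on `𝕍` gives it modulus
  -- one.
  exact map_conj_unitary hω (v_mem_unitary l)
    (conj_mul_self_of_mem_pureStates hp hU fun b => Subtype.ext (commute_v b.2 l)) a

/-- The competitors `φ`, `ψ` range over all states of `𝕎`, invariant or not. Purity on `𝕍` makes `φ`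
restrict to `ω`; then `φ` is automatically invariant, hence equal to the extension of `ω`. -/
theorem extendState_mem_pureInvStates {ω : WeakDual ℂ (subalgV d)}
    (hω : ω ∈ pureStates (subalgV d)) : extendState ω ∈ pureInvStates d := by
  have hinv := extendState_mem_invStates hω.1
  refine ⟨hinv, mem_extremePoints_iff_left.2 ⟨hinv.1, fun φ hφ ψ hψ hseg => ?_⟩⟩
  have h := restrictState_openSegment hseg
  rw [restrictState_extendState] at h
  have h1 := (mem_extremePoints_iff_left.1 hω).2 _ (restrictState_mem_stateSpace hφ) _
    (restrictState_mem_stateSpace hψ) h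
  rw [← extendState_restrictState
    (map_translation_of_restrictState_mem_pureStates hφ (h1 ▸ hω)), h1]

/-- The homeomorphism of the states of `𝕍` with the translationally invariant states of `𝕎`. -/
noncomputable def invStatesHomeomorph (d : ℕ) : stateSpace (subalgV d) ≃ₜ invStates d where
  toFun ω := ⟨extendState ω.1, extendState_mem_invStates ω.2⟩
  invFun ω := ⟨restrictState ω.1, restrictState_mem_stateSpace ω.2.1⟩
  left_inv ω := Subtype.ext (restrictState_extendState ω.1)
  right_inv ω := Subtype.ext (extendState_restrictState ω.2.2)
  continuous_toFun := (continuous_extendState.comp continuous_subtype_val).subtype_mk _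
  continuous_invFun := (continuous_restrictState.comp continuous_subtype_val).subtype_mk _

/-- The homeomorphism of the pure states of `𝕍` with the translationally invariant pure states
of `𝕎`. -/
noncomputable def pureInvStatesHomeomorph (d : ℕ) :
    pureStates (subalgV d) ≃ₜ pureInvStates d where
  toFun ω := ⟨extendState ω.1, extendState_mem_pureInvStates ω.2⟩
  invFun ω := ⟨restrictState ω.1, restrictState_mem_pureStates ω.2⟩
  left_inv ω := Subtype.ext (restrictState_extendState ω.1)
  right_inv ω := Subtype.ext (extendState_restrictState ω.2.1.2)
  continuous_toFun := (continuous_extendState.comp continuous_subtype_val).subtype_mk _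
  continuous_invFun := (continuous_restrictState.comp continuous_subtype_val).subtype_mk _

end WeylAlgebra

/-- Integrability and convergence are stated separately because the integral and `limUnder` have
default values. `Ψ` obeys the same formula as `Φ`, which makes it the restriction of `Φ`. -/
theorem mainTheorem4 (d : ℕ) :
    (∀ (a : WeylAlgebra d) (L : ℝ),
      IntegrableOn (fun l => WeylAlgebra.translation l a) (WeylAlgebra.cube d L)) ∧
    (∀ a : WeylAlgebra d,
      Tendsto (fun L : ℝ => WeylAlgebra.cubeMean L a) atTop (𝓝 (WeylAlgebra.ergodicMean a))) ∧
    ∃ hV : ∀ a : WeylAlgebra d, WeylAlgebra.ergodicMean a ∈ WeylAlgebra.subalgV d,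
    ∃ Φ : stateSpace (WeylAlgebra.subalgV d) ≃ₜ invStates d,
    ∃ Ψ : pureStates (WeylAlgebra.subalgV d) ≃ₜ pureInvStates d,
      (∀ (ω' : stateSpace (WeylAlgebra.subalgV d)) (a : WeylAlgebra d),
        (Φ ω').1 a = ω'.1 ⟨WeylAlgebra.ergodicMean a, hV a⟩) ∧
      (∀ (ω' : pureStates (WeylAlgebra.subalgV d)) (a : WeylAlgebra d),
        (Ψ ω').1 a = ω'.1 ⟨WeylAlgebra.ergodicMean a, hV a⟩) :=
  ⟨WeylAlgebra.integrableOn_translation, WeylAlgebra.tendsto_cubeMean,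
    WeylAlgebra.ergodicMean_mem_subalgV, WeylAlgebra.invStatesHomeomorph d,
    WeylAlgebra.pureInvStatesHomeomorph d, fun _ _ => rfl, fun _ _ => rfl⟩
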